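/- Let $\mathcal F$ be an algebraically closed field of characteristic zero with a field automorphism $\sigma$ (an algebraically closed inversive difference field). Let $\mathcal F\{\mathbb Y^{\pm}\}$ be the ring of Laurent $\sigma$-polynomials in $y_1,\dots,y_n$, i.e. the $\mathcal F$-vector space with basis the Laurent $\sigma$-monomials $\mathbb Y^{\mathbf f}$, $\mathbf f\in\mathbb Z[x]^n$, with $\mathbb Y^{\mathbf f}\mathbb Y^{\mathbf g}=\mathbb Y^{\mathbf f+\mathbf g}$ and $\sigma(a\mathbb Y^{\mathbf f})=\sigma(a)\mathbb Y^{x\mathbf f}$. A $\sigma$-ideal is an ideal $J$ with $\sigma(J)\subseteq J$; it is reflexive if $\sigma(p)\in J$ implies $p\in J$, and perfect if $\prod_i\sigma^i(p)^{a_i}\in J$ for some $0\neq\sum_i a_ix^i\in\mathbb N[x]$ implies $p\in J$; prime ideals are proper. A $\sigma$-ideal is called Laurent binomial if it is generated, as a $\sigma$-ideal, by elements with at most two terms $a\mathbb Y^{\mathbf g}+b\mathbb Y^{\mathbf h}$. The support lattice of such an ideal $J$ is $\{\mathbf f\in\mathbb Z[x]^n : \exists c\in\mathcal F^*,\ \mathbb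 Y^{\mathbf f}-c\in J\}$, and the saturation of $L\subseteq\mathbb Z[x]^n$ is $\mathrm{sat}(L)=\{\mathbf f\in\mathbb Z[x]^n : \exists\, a\in\mathbb Z\setminus\{0\},\ k\in\mathbb N,\ a x^k\mathbf f\in L\}$. **Theorem.** Let $\mathcal I\subseteq\mathcal F\{\mathbb Y^{\pm}\}$ be a Laurent binomial $\sigma$-ideal with support lattice $L$, and let $\{\mathcal I\}$ be its perfect closure, the smallest perfect $\sigma$-ideal containing $\mathcal I$. Then either $\{\mathcal I\}=[1]$ is the unit ideal, or $\{\mathcal I\}$ is the intersection of a nonempty finite set of reflexive prime Laurent binomial $\sigma$-ideals, each of which has support lattice $\mathrm{sat}(L)$. Moreover $\mathcal I$ is dimensionally unmixed: all minimal elements $\mathcal P$ of the set of reflexive prime $\sigma$-ideals containing $\mathcal I$ (the components of $\mathcal I$) have the same dimension, where the dimension of $\mathcal P$ is the $\sigma$-transcendence degree over $\mathcal F$ of the fraction field of $\mathcal F\{\mathbb Y^{\pm}\}/\mathcal P$ with the induced endomorphism $\sigma$, that is, the largest cardinality of a subset $S$ such that the family $(\sigma^k s)_{s\in S,\,k\ge0}$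 is algebraically independent over $\mathcal F$. -/

import Mathlib

open Polynomial

noncomputable section

namespace LaurentDiff

/-! ### Difference rings: a commutative ring `R` with a ring endomorphism `σ` -/

section DiffRing

variable {R : Type*} [CommRing R] (σ : R →+* R)

/-- `I` is a `σ`-ideal: an ideal with `σ(I) ⊆ I`. -/
def IsDiffIdeal (I : Ideal R) : Prop :=
  ∀ p ∈ I, σ p ∈ I

/-- `p ^ a = ∏ i, (σ^i p) ^ (a i)` for `a = ∑ i, a i * x ^ i` in `ℕ[x]`. -/
def diffPow (p : R) (a : ℕ[X]) : R :=
  ∏ i ∈ a.support, (σ^[i] p) ^ a.coeff i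

/-- A perfect `σ`-ideal: `p ^ a ∈ I` with `a ∈ ℕ[x]` nonzero implies `p ∈ I`. -/
def IsPerfect (I : Ideal R) : Prop :=
  IsDiffIdeal σ I ∧ ∀ (p : R) (a : ℕ[X]), a ≠ 0 → diffPow σ p a ∈ I → p ∈ I

/-- The `σ`-ideal `[B]` generated by a set `B`. -/
def diffSpan (B : Set R) : Ideal R :=
  sInf {J | IsDiffIdeal σ J ∧ B ⊆ J}

/-- The perfect closure `{I}`: the smallest perfect `σ`-ideal containing `I`. -/
def perfectClosure (I : Ideal R) : Ideal R :=
  sInf {J | IsPerfect σ J ∧ I ≤ J}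

theorem isDiffIdeal_diffSpan (B : Set R) : IsDiffIdeal σ (diffSpan σ B) := by
  intro p hp
  rw [diffSpan, Ideal.mem_sInf] at hp ⊢
  exact fun {J} hJ => hJ.1 p (hp hJ)

theorem isPerfect_perfectClosure (I : Ideal R) : IsPerfect σ (perfectClosure σ I) := by
  refine ⟨fun p hp => ?_, fun p a ha hp => ?_⟩
  · rw [perfectClosure, Ideal.mem_sInf] at hp ⊢
    exact fun {J} hJ => hJ.1.1 p (hp hJ)
  · rw [perfectClosure, Ideal.mem_sInf] at hp ⊢
    exact fun {J} hJ => hJ.1.2 p a ha (hp hJ)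

/-- A reflexive prime `σ`-ideal (prime ideals are proper). -/
structure IsReflexivePrime (P : Ideal R) : Prop where
  diff : IsDiffIdeal σ P
  reflexive : ∀ p, σ p ∈ P → p ∈ P
  prime : P.IsPrime

variable {σ}

/-- The endomorphism induced by `σ` on the residue ring `R ⧸ P`. -/
def IsReflexivePrime.quotientShift {P : Ideal R} (hP : IsReflexivePrime σ P) :
    R ⧸ P →+* R ⧸ P :=
  Ideal.quotientMap P σ hP.diff

theorem IsReflexivePrime.quotientShift_injective {P : Ideal R} (hP : IsReflexivePrime σ P) :
    Function.Injective hP.quotientShift :=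
  Ideal.quotientMap_injective' (H := hP.diff) hP.reflexive

/-- The endomorphism induced by `σ` on the field of fractions of `R ⧸ P`. When `R` is the ring of
Laurent `σ`-polynomials over `F`, this `σ`-field is `F⟨η⟩`, where `η` (the tuple of the classes of
the indeterminates) is a generic zero of `P`. -/
def IsReflexivePrime.fractionShift {P : Ideal R} (hP : IsReflexivePrime σ P) :
    FractionRing (R ⧸ P) →+* FractionRing (R ⧸ P) :=
  haveI : P.IsPrime := hP.prime
  IsFractionRing.map (A := R ⧸ P) (B := R ⧸ P) hP.quotientShift_injective

end DiffRing

/-- `S` is `σ`-independent over `F`: the elements `σ^k a`, for `a ∈ S` and `k ≥ 0`, form an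
algebraically independent family over `F`. -/
def SigmaIndependent (F : Type*) {K : Type*} [CommRing F] [CommRing K] [Algebra F K]
    (τ : K →+* K) (S : Set K) : Prop :=
  AlgebraicIndependent F (fun q : S × ℕ => τ^[q.2] (q.1 : K))

/-- The `σ`-transcendence degree over `F`: the largest cardinality of a `σ`-independent set. -/
def sigmaTrdeg (F : Type*) {K : Type*} [CommRing F] [CommRing K] [Algebra F K]
    (τ : K →+* K) : ℕ∞ :=
  ⨆ S : {S : Set K // SigmaIndependent F τ S}, S.1.encard

/-- The dimension of a reflexive prime `σ`-ideal: the `σ`-transcendence degree over `F` of the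
`σ`-field generated by a generic zero. -/
def IsReflexivePrime.dimension (F : Type*) {R : Type*} [CommRing F] [CommRing R] [Algebra F R]
    {σ : R →+* R} {P : Ideal R} (hP : IsReflexivePrime σ P) : ℕ∞ :=
  sigmaTrdeg F hP.fractionShift

/-- `P` is a (reflexive prime) component of `I`: it is minimal among the reflexive prime
`σ`-ideals containing `I`. -/
def IsComponent {R : Type*} [CommRing R] (σ : R →+* R) (I P : Ideal R) : Prop :=
  Minimal (fun Q => IsReflexivePrime σ Q ∧ I ≤ Q) P

/-- `I` is dimensionally unmixed: all its components have the same dimension. -/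
def IsDimensionallyUnmixed (F : Type*) {R : Type*} [CommRing F] [CommRing R] [Algebra F R]
    (σ : R →+* R) (I : Ideal R) : Prop :=
  ∀ (P Q : Ideal R) (hP : IsComponent σ I P) (hQ : IsComponent σ I Q),
    hP.prop.1.dimension F = hQ.prop.1.dimension F

/-! ### Laurent difference polynomials -/

/-- The ring `F{Y^±}` of Laurent `σ`-polynomials in `y_1, …, y_n`: the `F`-linear combinations of
the Laurent `σ`-monomials `Y ^ f = ∏ i, y_i ^ (f i)`, `f ∈ ℤ[x]^n`, where `y_i ^ (x ^ k)` is the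
`k`-th transform of `y_i`; that is, the group algebra of `ℤ[x]^n`. -/
abbrev LaurentRing (F : Type*) [Field F] (n : ℕ) : Type _ :=
  AddMonoidAlgebra F (Fin n → ℤ[X])

variable {F : Type*} [Field F] {n : ℕ}

/-- The Laurent `σ`-monomial `Y ^ f`. -/
def mono (F : Type*) [Field F] {n : ℕ} (f : Fin n → ℤ[X]) : LaurentRing F n :=
  AddMonoidAlgebra.single f 1

/-- Multiplication by `x` on `ℤ[x]^n`. -/
def mulX (n : ℕ) : (Fin n → ℤ[X]) →+ (Fin n → ℤ[X]) :=
  DistribSMul.toAddMonoidHom (Fin n → ℤ[X]) (X : ℤ[X])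

/-- The transforming operator of `F{Y^±}`: `a * Y ^ f ↦ σ(a) * Y ^ (x * f)`. -/
def shift (σ : F →+* F) (n : ℕ) : LaurentRing F n →+* LaurentRing F n :=
  (AddMonoidAlgebra.mapRingHom (Fin n → ℤ[X]) σ).comp
    (AddMonoidAlgebra.mapDomainRingHom F (mulX n))

theorem shift_single (σ : F →+* F) (f : Fin n → ℤ[X]) (a : F) :
    shift σ n (AddMonoidAlgebra.single f a) =
      AddMonoidAlgebra.single ((X : ℤ[X]) • f) (σ a) := by
  simp [shift, mulX]

/-- A Laurent `σ`-binomial: at most two terms, `a * Y ^ g + b * Y ^ h`. -/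
def IsBinomial (p : LaurentRing F n) : Prop :=
  ∃ (a b : F) (g h : Fin n → ℤ[X]), p = a • mono F g + b • mono F h

/-- A Laurent binomial `σ`-ideal: a `σ`-ideal generated by Laurent `σ`-binomials. -/
def IsLaurentBinomial (σ : F →+* F) (I : Ideal (LaurentRing F n)) : Prop :=
  ∃ B : Set (LaurentRing F n), (∀ p ∈ B, IsBinomial p) ∧ I = diffSpan (shift σ n) B

/-- The support lattice `{f ∈ ℤ[x]^n | ∃ c ∈ F^*, Y ^ f - c ∈ I}`, as a subset of `ℤ[x]^n`. -/
def supportLattice (I : Ideal (LaurentRing F n)) : Set (Fin n → ℤ[X]) :=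
  {f | ∃ c : F, c ≠ 0 ∧ mono F f - algebraMap F (LaurentRing F n) c ∈ I}

/-- The saturation `sat(L) = {f | ∃ a ∈ ℤ, a ≠ 0, ∃ k ∈ ℕ, a * x ^ k * f ∈ L}`. -/
def saturation (L : Set (Fin n → ℤ[X])) : Set (Fin n → ℤ[X]) :=
  {f | ∃ a : ℤ, a ≠ 0 ∧ ∃ k : ℕ, (C a * X ^ k : ℤ[X]) • f ∈ L}

end LaurentDiff

end

namespace LaurentDiff

/-! ### Perfect ideals as intersections of reflexive primes. -/

section DiffRing

variable {R : Type*} [CommRing R] {σ : R →+* R}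

/-! Write R for the Laurent ring, N = sat(L), and y^f for the class of Y^f modulo a reflexive prime
P ⊇ I. For f in N, some positive power of y^(x^k f) is a constant. Since F is algebraically closed
and R/P is a domain, y^(x^k f) is itself a constant; surjectivity of σ and reflexivity of P then
make y^f a constant (`saturation_subset_supportLattice`). The binomials Y^f - c in P with f in N
generate an ideal `constPart P N`, which still contains I because each nonzero binomial in I is a
unit times some Y^f - c with f in L.

The key fact is that `constPart P N` is the kernel of Y^f ↦ y^f [f] into the group algebra of
ℤ[x]^n/N over R/P (`ker_gradedClass`). As ℤ[x]^n/N has neither ℤ-torsion nor x-torsion, this algebra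
is a domain with an injective shift, so `constPart P N` is a reflexive prime, and its support
lattice is exactly N. A perfect ideal is an intersection of reflexive primes, so the perfect closure
of I is the intersection of these binomial primes. They are finitely many: each is determined by its
constants at finitely many generators of N, and such a constant solves a fixed equation σ^k(c)^m =
d.

By minimality every component is a binomial prime. Its dimension is the size of a maximal set s of
standard basis vectors independent modulo N, which does not depend on the prime. The same kernel
description shows that the y_j with j in s are σ-independent. Conversely, the monomials of order
less than T are algebraic over |s|T + O(1) of them, which bounds the size of any σ-independent set
(`card_le_of_sigmaIndependent`). -/

theorem diffPow_C (p : R) (m : ℕ) (hm : m ≠ 0) : diffPow σ p (C m) = p ^ m := by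
  rw [diffPow, Polynomial.support_C hm]
  simp

theorem diffPow_X (p : R) : diffPow σ p X = σ p := by
  simp [diffPow, Polynomial.support_X]

theorem diffPow_one_add_X (p : R) : diffPow σ p (1 + X) = p * σ p := by
  have h : (1 + X : ℕ[X]).support = {0, 1} := by
    ext i
    rcases i with _ | _ | i <;> simp [Polynomial.coeff_one, Polynomial.coeff_X]
  simp [diffPow, h, Polynomial.coeff_one, Polynomial.coeff_X]

theorem diffPow_mul (p q : R) (a : ℕ[X]) :
    diffPow σ (p * q) a = diffPow σ p a * diffPow σ q a := by
  simp [diffPow, iterate_map_mul, mul_pow, Finset.prod_mul_distrib]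

theorem IsPerfect.of_pow {J : Ideal R} (hJ : IsPerfect σ J) {p : R} {m : ℕ} (hm : m ≠ 0)
    (h : p ^ m ∈ J) : p ∈ J :=
  hJ.2 p (C m) (by simpa using hm) (by rwa [diffPow_C p m hm])

theorem IsPerfect.reflexive {J : Ideal R} (hJ : IsPerfect σ J) {p : R} (h : σ p ∈ J) : p ∈ J :=
  hJ.2 p X X_ne_zero (by rwa [diffPow_X])

theorem IsPerfect.of_mul_shift {J : Ideal R} (hJ : IsPerfect σ J) {p : R} (h : p * σ p ∈ J) :
    p ∈ J := by
  refine hJ.2 p (1 + X) (fun h0 => ?_) (by rwa [diffPow_one_add_X])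
  simpa [Polynomial.coeff_one] using congrArg (fun r : ℕ[X] => r.coeff 0) h0

theorem IsPerfect.mul_shift_mem {J : Ideal R} (hJ : IsPerfect σ J) {p q : R} (h : p * q ∈ J) :
    p * σ q ∈ J := by
  apply hJ.of_mul_shift
  have : p * σ q * σ (p * σ q) = (p * σ (σ q)) * σ (p * q) := by simp only [map_mul]; ring
  rw [this]
  exact J.mul_mem_left _ (hJ.1 _ h)

theorem IsPerfect.mul_iterate_shift_mem {J : Ideal R} (hJ : IsPerfect σ J) {p q : R}
    (h : p * q ∈ J) (k : ℕ) : p * σ^[k] q ∈ J := by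
  induction k with
  | zero => exact h
  | succ k ih => rw [Function.iterate_succ_apply']; exact hJ.mul_shift_mem ih

/-- The ideal quotient of `J` by the element `a`. -/
def colonElement (J : Ideal R) (a : R) : Ideal R :=
  Submodule.comap (LinearMap.mulLeft R a) J

theorem mem_colonElement {J : Ideal R} {a q : R} : q ∈ colonElement J a ↔ a * q ∈ J :=
  Iff.rfl

theorem IsPerfect.colonElement {J : Ideal R} (hJ : IsPerfect σ J) (a : R) :
    IsPerfect σ (colonElement J a) := by
  refine ⟨fun q hq => hJ.mul_shift_mem hq, fun q c hc hq => ?_⟩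
  rw [mem_colonElement] at hq ⊢
  obtain ⟨i, hi⟩ := Polynomial.support_nonempty.mpr hc
  have h1 : diffPow σ q c * σ^[i] a ∈ J :=
    hJ.mul_iterate_shift_mem (by rwa [mul_comm]) i
  apply hJ.2 _ c hc
  -- One factor σ^i(a), with i in the support of c, suffices to make (aq)^c a multiple of an element
  -- of J.
  have h2 : σ^[i] a ∣ diffPow σ a c :=
    (dvd_pow_self _ (Polynomial.mem_support_iff.mp hi)).trans
      (Finset.dvd_prod_of_mem (fun i => (σ^[i] a) ^ c.coeff i) hi)
  rw [diffPow_mul, mul_comm]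
  exact J.mem_of_dvd (mul_dvd_mul_left _ h2) h1

theorem IsReflexivePrime.iterate_mem {P : Ideal R} (hP : IsReflexivePrime σ P) {p : R} {k : ℕ}
    (h : σ^[k] p ∈ P) : p ∈ P := by
  induction k with
  | zero => exact h
  | succ k ih => rw [Function.iterate_succ_apply'] at h; exact ih (hP.reflexive _ h)

theorem IsDiffIdeal.iterate_mem {P : Ideal R} (hP : IsDiffIdeal σ P) {p : R} (h : p ∈ P) (k : ℕ) :
    σ^[k] p ∈ P := by
  induction k with
  | zero => exact h
  | succ k ih => rw [Function.iterate_succ_apply']; exact hP _ ih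

theorem IsReflexivePrime.isPerfect {P : Ideal R} (hP : IsReflexivePrime σ P) :
    IsPerfect σ P := by
  refine ⟨hP.diff, fun p a _ h => ?_⟩
  have := hP.prime
  obtain ⟨i, -, hi⟩ := hP.prime.prod_mem_iff.mp h
  exact hP.iterate_mem (hP.prime.mem_of_pow_mem _ hi)

theorem isPerfect_sSup_of_isChain {c : Set (Ideal R)} (hc : ∀ J ∈ c, IsPerfect σ J)
    (hch : IsChain (· ≤ ·) c) (hne : c.Nonempty) : IsPerfect σ (sSup c) := by
  have hmem : ∀ p, p ∈ sSup c ↔ ∃ J ∈ c, p ∈ J := fun p =>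
    Submodule.mem_sSup_of_directed hne hch.directedOn
  refine ⟨fun p hp => ?_, fun p a ha hp => ?_⟩
  · obtain ⟨J, hJ, h⟩ := (hmem p).mp hp
    exact (hmem _).mpr ⟨J, hJ, (hc J hJ).1 p h⟩
  · obtain ⟨J, hJ, h⟩ := (hmem _).mp hp
    exact (hmem _).mpr ⟨J, hJ, (hc J hJ).2 p a ha h⟩

/-- A perfect ideal M maximal among those avoiding p is prime. Colon ideals of M are perfect, so by
maximality ab ∈ M and b ∉ M force ap ∈ M; using this twice gives p² ∈ M unless a or b lies in M. -/
theorem IsPerfect.exists_isReflexivePrime {J : Ideal R} (hJ : IsPerfect σ J) {p : R}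
    (hp : p ∉ J) : ∃ P, IsReflexivePrime σ P ∧ J ≤ P ∧ p ∉ P := by
  obtain ⟨M, hJM, hM⟩ := zorn_le_nonempty₀ {M : Ideal R | IsPerfect σ M ∧ p ∉ M}
    (fun c hc hch y hy => ⟨sSup c, ⟨isPerfect_sSup_of_isChain (fun J hJ => (hc hJ).1) hch ⟨y, hy⟩,
      fun h => by
        obtain ⟨J, hJ, h⟩ := (Submodule.mem_sSup_of_directed ⟨y, hy⟩ hch.directedOn).mp h
        exact (hc hJ).2 h⟩, fun z hz => le_sSup hz⟩) J ⟨hJ, hp⟩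
  have hper : IsPerfect σ M := hM.prop.1
  have hpM : p ∉ M := hM.prop.2
  have key : ∀ {a b : R}, a * b ∈ M → b ∉ M → a * p ∈ M := by
    intro a b hab hb
    by_contra hcon
    have hle : M ≤ LaurentDiff.colonElement M a := fun q hq => M.mul_mem_left a hq
    exact hb (hM.le_of_ge ⟨hper.colonElement a, hcon⟩ hle hab)
  refine ⟨M, ⟨hper.1, fun q hq => hper.reflexive hq, ?_⟩, hJM, hpM⟩
  refine Ideal.isPrime_iff.mpr ⟨fun h => hpM (h ▸ Submodule.mem_top), fun {a b} hab => ?_⟩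
  by_contra! hcon
  have h1 : a * p ∈ M := key hab hcon.2
  have h2 : p * p ∈ M := key (by rwa [mul_comm]) hcon.1
  exact hpM (hper.of_pow two_ne_zero (by rwa [sq]))

theorem perfectClosure_le {I J : Ideal R} (hJ : IsPerfect σ J) (h : I ≤ J) :
    perfectClosure σ I ≤ J :=
  sInf_le ⟨hJ, h⟩

theorem le_perfectClosure (I : Ideal R) : I ≤ perfectClosure σ I :=
  le_sInf fun _ hJ => hJ.2

theorem perfectClosure_eq_sInf (I : Ideal R) :
    perfectClosure σ I = sInf {P | IsReflexivePrime σ P ∧ I ≤ P} := by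
  apply le_antisymm
  · exact le_sInf fun P hP => perfectClosure_le hP.1.isPerfect hP.2
  · intro p hp
    by_contra hcon
    obtain ⟨P, hP, hle, hpP⟩ := (isPerfect_perfectClosure σ I).exists_isReflexivePrime hcon
    exact hpP (Ideal.mem_sInf.mp hp ⟨hP, (le_perfectClosure I).trans hle⟩)

theorem diffSpan_le {B : Set R} {J : Ideal R} (hJ : IsDiffIdeal σ J) (h : B ⊆ J) :
    diffSpan σ B ≤ J :=
  sInf_le ⟨hJ, h⟩

theorem subset_diffSpan (B : Set R) : B ⊆ diffSpan σ B :=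
  fun _ hp => Ideal.mem_sInf.mpr fun {_} hJ => hJ.2 hp

end DiffRing
-- A torsion-free abelian group embeds in its localization at the nonzero integers, a ℚ-vector
-- space. Unique sums are what make a group algebra over a domain a domain.
theorem twoUniqueSums_of_isAddTorsionFree (G : Type*) [AddCommGroup G] [IsAddTorsionFree G] :
    TwoUniqueSums G := by
  let _ : Module ℚ (LocalizedModule (nonZeroDivisors ℤ) G) :=
    Module.compHom _ ((FractionRing.algEquiv ℤ ℚ).symm : ℚ →+* FractionRing ℤ)
  refine TwoUniqueSums.of_injective_addHom
    (LocalizedModule.mkLinearMap (nonZeroDivisors ℤ) G).toAddMonoidHom.toAddHom ?_ inferInstance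
  intro a b h
  obtain ⟨u, hu⟩ := LocalizedModule.mk_eq.mp h
  simp only [one_smul] at hu
  exact zsmul_right_injective (nonZeroDivisors.ne_zero u.2) hu

/-! ### Laurent monomials are units, and constants modulo a proper ideal are unique. -/

section Monomials

variable {F : Type*} [Field F] {n : ℕ}

theorem mono_add (f g : Fin n → ℤ[X]) : mono F (f + g) = mono F f * mono F g := by
  simp [mono, AddMonoidAlgebra.single_mul_single]

theorem mono_zero : mono F (0 : Fin n → ℤ[X]) = 1 := rfl

theorem mono_nsmul (m : ℕ) (f : Fin n → ℤ[X]) : mono F (m • f) = mono F f ^ m := by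
  simp [mono, AddMonoidAlgebra.single_pow]

theorem mono_neg_mul (f : Fin n → ℤ[X]) : mono F (-f) * mono F f = 1 := by
  rw [← mono_add, neg_add_cancel, mono_zero]

theorem isUnit_mono (f : Fin n → ℤ[X]) : IsUnit (mono F f) :=
  IsUnit.of_mul_eq_one_right _ (mono_neg_mul f)

theorem single_eq_smul_mono (f : Fin n → ℤ[X]) (c : F) :
    AddMonoidAlgebra.single f c = c • mono F f := by
  simp [mono, AddMonoidAlgebra.smul_single]

theorem single_eq_mul_mono (f : Fin n → ℤ[X]) (c : F) :
    AddMonoidAlgebra.single f c = algebraMap F (LaurentRing F n) c * mono F f := by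
  rw [single_eq_smul_mono, Algebra.smul_def]

theorem shift_mono (σ : F →+* F) (f : Fin n → ℤ[X]) :
    shift σ n (mono F f) = mono F ((X : ℤ[X]) • f) := by
  simp [mono, shift_single]

theorem shift_algebraMap (σ : F →+* F) (c : F) :
    shift σ n (algebraMap F _ c) = algebraMap F (LaurentRing F n) (σ c) := by
  have h : ∀ c : F, algebraMap F (LaurentRing F n) c = AddMonoidAlgebra.single 0 c := fun _ => rfl
  rw [h, h, shift_single, smul_zero]

theorem iterate_shift_mono (σ : F →+* F) (f : Fin n → ℤ[X]) (k : ℕ) :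
    (shift σ n)^[k] (mono F f) = mono F ((X ^ k : ℤ[X]) • f) := by
  induction k with
  | zero => simp
  | succ k ih => rw [Function.iterate_succ_apply', ih, shift_mono, smul_smul, pow_succ']

theorem iterate_shift_algebraMap (σ : F →+* F) (c : F) (k : ℕ) :
    (shift σ n)^[k] (algebraMap F _ c) = algebraMap F (LaurentRing F n) (σ^[k] c) := by
  induction k with
  | zero => rfl
  | succ k ih => rw [Function.iterate_succ_apply', ih, shift_algebraMap,
      Function.iterate_succ_apply']

theorem mono_notMem {P : Ideal (LaurentRing F n)} (hP : P ≠ ⊤) (f : Fin n → ℤ[X]) :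
    mono F f ∉ P :=
  fun h => hP (P.eq_top_of_isUnit_mem h (isUnit_mono f))

theorem eq_of_mono_sub_mem {P : Ideal (LaurentRing F n)} (hP : P ≠ ⊤) {f : Fin n → ℤ[X]}
    {c d : F} (hc : mono F f - algebraMap F _ c ∈ P) (hd : mono F f - algebraMap F _ d ∈ P) :
    c = d := by
  by_contra hne
  have h := P.sub_mem hd hc
  rw [sub_sub_sub_cancel_left, ← map_sub] at h
  exact hP (P.eq_top_of_isUnit_mem h ((sub_ne_zero.mpr hne).isUnit.map _))

theorem ne_zero_of_mono_sub_mem {P : Ideal (LaurentRing F n)} (hP : P ≠ ⊤) {f : Fin n → ℤ[X]}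
    {c : F} (hc : mono F f - algebraMap F _ c ∈ P) : c ≠ 0 := by
  rintro rfl
  exact mono_notMem hP f (by simpa using hc)

theorem mono_sub_mem_iff {P : Ideal (LaurentRing F n)} {f : Fin n → ℤ[X]} {c : F} :
    mono F f - algebraMap F _ c ∈ P ↔
      Ideal.Quotient.mk P (mono F f) = algebraMap F (LaurentRing F n ⧸ P) c :=
  (Ideal.Quotient.eq).symm

end Monomials

/-! ### Support lattices and saturated submodules. -/

section SupportLattice

variable {F : Type*} [Field F] {n : ℕ}

theorem mem_supportLattice {I : Ideal (LaurentRing F n)} {f : Fin n → ℤ[X]} :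
    f ∈ supportLattice I ↔
      ∃ c : F, c ≠ 0 ∧ Ideal.Quotient.mk I (mono F f) = algebraMap F _ c := by
  simp only [← mono_sub_mem_iff]
  rfl

/-- An additive subgroup stable under multiplication by `X` is a `ℤ[X]`-submodule. -/
noncomputable def submoduleOfX {M : Type*} [AddCommGroup M] [Module ℤ[X] M] (G : AddSubgroup M)
    (hG : ∀ f ∈ G, (X : ℤ[X]) • f ∈ G) : Submodule ℤ[X] M where
  toAddSubmonoid := G.toAddSubmonoid
  smul_mem' p f hf := by
    have hpow : ∀ k : ℕ, (X ^ k : ℤ[X]) • f ∈ G := by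
      intro k
      induction k with
      | zero => simpa using hf
      | succ k ih => rw [pow_succ', mul_smul]; exact hG _ ih
    change p • f ∈ G
    induction p using Polynomial.induction_on' with
    | add p q hp hq => rw [add_smul]; exact G.add_mem hp hq
    | monomial k a =>
      rw [← Polynomial.C_mul_X_pow_eq_monomial, mul_smul, eq_intCast (C : ℤ →+* ℤ[X]),
        Int.cast_smul_eq_zsmul]
      exact G.zsmul_mem (hpow k) a

variable {σ : F →+* F}

/-- The support lattice of a `σ`-ideal, as a `ℤ[x]`-submodule. -/
noncomputable def supportSubmodule {I : Ideal (LaurentRing F n)} (hI : IsDiffIdeal (shift σ n) I) :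
    Submodule ℤ[X] (Fin n → ℤ[X]) :=
  submoduleOfX
    { carrier := supportLattice I
      zero_mem' := mem_supportLattice.mpr ⟨1, one_ne_zero, by simp [mono_zero]⟩
      add_mem' := fun {f g} hf hg => by
        obtain ⟨c, hc, h1⟩ := mem_supportLattice.mp hf
        obtain ⟨d, hd, h2⟩ := mem_supportLattice.mp hg
        exact mem_supportLattice.mpr ⟨c * d, mul_ne_zero hc hd, by
          rw [mono_add, map_mul, h1, h2, map_mul]⟩
      neg_mem' := fun {f} hf => by
        obtain ⟨c, hc, h1⟩ := mem_supportLattice.mp hf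
        refine mem_supportLattice.mpr ⟨c⁻¹, inv_ne_zero hc, ?_⟩
        have h2 := congrArg (Ideal.Quotient.mk I) (mono_neg_mul (F := F) f)
        rw [map_mul, h1, map_one] at h2
        have h3 : algebraMap F (LaurentRing F n ⧸ I) c * algebraMap F _ c⁻¹ = 1 := by
          rw [← map_mul, mul_inv_cancel₀ hc, map_one]
        exact left_inv_eq_right_inv h2 h3 }
    (by
      rintro f ⟨c, hc, h⟩
      refine ⟨σ c, (map_ne_zero σ).mpr hc, ?_⟩
      have := hI _ h
      rwa [map_sub, shift_mono, shift_algebraMap] at this)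

/-- A submodule of a `ℤ[x]`-module whose quotient has no `ℤ`-torsion and no `x`-torsion. -/
structure IsSaturated {M : Type*} [AddCommGroup M] [Module ℤ[X] M] (N : Submodule ℤ[X] M) :
    Prop where
  of_nsmul : ∀ (m : ℕ) (f : M), m ≠ 0 → m • f ∈ N → f ∈ N
  of_X_smul : ∀ f : M, (X : ℤ[X]) • f ∈ N → f ∈ N

theorem IsSaturated.isAddTorsionFree {M : Type*} [AddCommGroup M] [Module ℤ[X] M]
    {N : Submodule ℤ[X] M} (hN : IsSaturated N) : IsAddTorsionFree (M ⧸ N) where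
  nsmul_right_injective m hm a b hab := by
    obtain ⟨f, rfl⟩ := N.mkQ_surjective a
    obtain ⟨g, rfl⟩ := N.mkQ_surjective b
    have h : N.mkQ (m • (f - g)) = 0 := by
      rw [map_nsmul, map_sub, smul_sub, sub_eq_zero]; exact hab
    rw [← sub_eq_zero, ← map_sub]
    rw [Submodule.mkQ_apply, Submodule.Quotient.mk_eq_zero] at h ⊢
    exact hN.of_nsmul m _ hm h

theorem IsSaturated.X_smul_injective {M : Type*} [AddCommGroup M] [Module ℤ[X] M]
    {N : Submodule ℤ[X] M} (hN : IsSaturated N) :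
    Function.Injective (fun a : M ⧸ N => (X : ℤ[X]) • a) := by
  intro a b hab
  obtain ⟨f, rfl⟩ := N.mkQ_surjective a
  obtain ⟨g, rfl⟩ := N.mkQ_surjective b
  have h : N.mkQ ((X : ℤ[X]) • (f - g)) = 0 := by
    rw [map_smul, map_sub, smul_sub, sub_eq_zero]; exact hab
  rw [← sub_eq_zero, ← map_sub]
  rw [Submodule.mkQ_apply, Submodule.Quotient.mk_eq_zero] at h ⊢
  exact hN.of_X_smul _ h

end SupportLattice

/-! ### The binomial part of a reflexive prime, as the kernel of a graded homomorphism. -/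

section ConstPart

variable {F : Type*} [Field F] {n : ℕ} {σ : F →+* F}

/-- The binomials `Y ^ f - c` in `P` with exponent `f` in `N`. -/
def constBinomials (P : Ideal (LaurentRing F n)) (N : Submodule ℤ[X] (Fin n → ℤ[X])) :
    Set (LaurentRing F n) :=
  {p | ∃ f ∈ N, ∃ c : F, p = mono F f - algebraMap F _ c ∧ p ∈ P}

/-- The ideal generated by the binomials `Y ^ f - c` in `P` with exponent `f` in `N`. -/
noncomputable def constPart (P : Ideal (LaurentRing F n)) (N : Submodule ℤ[X] (Fin n → ℤ[X])) :
    Ideal (LaurentRing F n) :=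
  Ideal.span (constBinomials P N)

theorem constPart_le (P : Ideal (LaurentRing F n)) (N : Submodule ℤ[X] (Fin n → ℤ[X])) :
    constPart P N ≤ P := by
  rw [constPart, Ideal.span_le]
  rintro p ⟨f, -, c, -, hp⟩
  exact hp

/-- The homomorphism `Y ^ f ↦ y ^ f [f]` to the group algebra of `ℤ[x]^n ⧸ N` over the residue
ring of `P`, where `y ^ f` is the residue class of `Y ^ f`. -/
noncomputable def gradedClass (P : Ideal (LaurentRing F n))
    (N : Submodule ℤ[X] (Fin n → ℤ[X])) :
    LaurentRing F n →ₐ[F] AddMonoidAlgebra (LaurentRing F n ⧸ P) ((Fin n → ℤ[X]) ⧸ N) :=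
  AddMonoidAlgebra.lift F _ _
    { toFun := fun f => AddMonoidAlgebra.single (N.mkQ f.toAdd)
        (Ideal.Quotient.mk P (mono F f.toAdd))
      map_one' := rfl
      map_mul' := fun f g => by
        simp [AddMonoidAlgebra.single_mul_single, mono_add] }

variable {P : Ideal (LaurentRing F n)} {N : Submodule ℤ[X] (Fin n → ℤ[X])}

theorem gradedClass_mono (f : Fin n → ℤ[X]) :
    gradedClass P N (mono F f) =
      AddMonoidAlgebra.single (N.mkQ f) (Ideal.Quotient.mk P (mono F f)) := by
  simp [gradedClass, mono]

theorem gradedClass_single (f : Fin n → ℤ[X]) (c : F) :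
    gradedClass P N (AddMonoidAlgebra.single f c) =
      AddMonoidAlgebra.single (N.mkQ f) (c • Ideal.Quotient.mk P (mono F f)) := by
  rw [single_eq_smul_mono, map_smul, gradedClass_mono, AddMonoidAlgebra.smul_single]

theorem gradedClass_algebraMap (c : F) :
    gradedClass P N (algebraMap F _ c) =
      AddMonoidAlgebra.single 0 (algebraMap F (LaurentRing F n ⧸ P) c) := by
  rw [AlgHom.commutes]
  rfl

theorem constPart_le_ker : constPart P N ≤ RingHom.ker (gradedClass P N) := by
  rw [constPart, Ideal.span_le]
  rintro p ⟨f, hf, c, rfl, hp⟩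
  have h0 : N.mkQ f = 0 := by simpa using hf
  rw [SetLike.mem_coe, RingHom.mem_ker, map_sub, gradedClass_mono, gradedClass_algebraMap, h0,
    mono_sub_mem_iff.mp hp, sub_self]

/-- Modulo `constPart P N`, monomials whose exponents are congruent modulo N differ by a nonzero
constant, so one representative per coset, given by the section `s`, is enough. -/
theorem exists_normalForm (hN : ∀ f ∈ N, f ∈ supportLattice P)
    (s : (Fin n → ℤ[X]) ⧸ N → (Fin n → ℤ[X])) (hs : ∀ m, N.mkQ (s m) = m)
    (p : LaurentRing F n) :
    ∃ d : ((Fin n → ℤ[X]) ⧸ N) →₀ F,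
      p - d.sum (fun m c => AddMonoidAlgebra.single (s m) c) ∈ constPart P N := by
  classical
  induction p using AddMonoidAlgebra.induction_linear with
  | zero => exact ⟨0, by simp⟩
  | add p q hp hq =>
    obtain ⟨d, hd⟩ := hp
    obtain ⟨e, he⟩ := hq
    refine ⟨d + e, ?_⟩
    rw [Finsupp.sum_add_index' (by simp) (by simp [AddMonoidAlgebra.single_add]),
      add_sub_add_comm]
    exact Ideal.add_mem _ hd he
  | single f c =>
    have hf : f - s (N.mkQ f) ∈ N := by
      rw [← Submodule.Quotient.mk_eq_zero, ← Submodule.mkQ_apply, map_sub, hs, sub_self]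
    obtain ⟨a, ha, h⟩ := hN _ hf
    refine ⟨Finsupp.single (N.mkQ f) (c * a), ?_⟩
    rw [Finsupp.sum_single_index (by simp)]
    have h1 : AddMonoidAlgebra.single f c - AddMonoidAlgebra.single (s (N.mkQ f)) (c * a) =
        (algebraMap F _ c * mono F (s (N.mkQ f))) *
          (mono F (f - s (N.mkQ f)) - algebraMap F (LaurentRing F n) a) := by
      have h2 : mono F f = mono F (s (N.mkQ f)) * mono F (f - s (N.mkQ f)) := by
        rw [← mono_add, add_sub_cancel]
      rw [single_eq_mul_mono, single_eq_mul_mono, h2, map_mul]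
      ring
    rw [h1]
    exact Ideal.mul_mem_left _ _ (Ideal.subset_span ⟨_, hf, a, rfl, h⟩)

/-- The terms of a normal form land on distinct basis elements [m], with coefficients d(m) y^(s m).
Since y^(s m) is a unit of the nonzero ring R/P, a normal form in the kernel vanishes. -/
theorem ker_gradedClass (hP : P ≠ ⊤) (hN : ∀ f ∈ N, f ∈ supportLattice P) :
    RingHom.ker (gradedClass P N) = constPart P N := by
  classical
  refine le_antisymm (fun p hp => ?_) constPart_le_ker
  obtain ⟨s, hs⟩ : ∃ s : _ → _, ∀ m, N.mkQ (s m) = m := N.mkQ_surjective.hasRightInverse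
  obtain ⟨d, hd⟩ := exists_normalForm hN s hs p
  have h1 : gradedClass P N (d.sum fun m c => AddMonoidAlgebra.single (s m) c) = 0 := by
    have h2 := constPart_le_ker hd
    rw [RingHom.mem_ker, map_sub, RingHom.mem_ker.mp hp, zero_sub, neg_eq_zero] at h2
    exact h2
  have h2 : d = 0 := by
    ext m
    have h3 := congrArg (fun q => q.coeff m) h1
    simp only [Finsupp.sum, map_sum, gradedClass_single, hs, AddMonoidAlgebra.coeff_sum,
      Finsupp.finsetSum_apply, AddMonoidAlgebra.coeff_single, Finsupp.single_apply,
      AddMonoidAlgebra.coeff_zero, Finsupp.coe_zero, Pi.zero_apply] at h3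
    rw [Finset.sum_ite_eq'] at h3
    by_contra hne
    rw [Finsupp.coe_zero, Pi.zero_apply] at hne
    rw [if_pos (Finsupp.mem_support_iff.mpr hne)] at h3
    have h4 : algebraMap F _ (d m) * mono F (s m) ∈ P := by
      rw [← Algebra.smul_def]
      exact Ideal.Quotient.eq_zero_iff_mem.mp h3
    exact mono_notMem hP (s m) ((P.unit_mul_mem_iff_mem ((Ne.isUnit hne).map _)).mp h4)
  simpa [h2] using hd

theorem isPrime_constPart (hP : P.IsPrime) (hN : ∀ f ∈ N, f ∈ supportLattice P)
    (hsat : IsSaturated N) : (constPart P N).IsPrime := by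
  have := hsat.isAddTorsionFree
  have := twoUniqueSums_of_isAddTorsionFree ((Fin n → ℤ[X]) ⧸ N)
  rw [← ker_gradedClass hP.ne_top hN]
  exact RingHom.ker_isPrime _

/-- The endomorphism of the group algebra of `ℤ[x]^n ⧸ N` over the residue ring of `P` induced by
`σ` and multiplication by `x`. -/
noncomputable def gradedShift (hP : IsReflexivePrime (shift σ n) P)
    (N : Submodule ℤ[X] (Fin n → ℤ[X])) :
    AddMonoidAlgebra (LaurentRing F n ⧸ P) ((Fin n → ℤ[X]) ⧸ N) →+*
      AddMonoidAlgebra (LaurentRing F n ⧸ P) ((Fin n → ℤ[X]) ⧸ N) :=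
  (AddMonoidAlgebra.mapRingHom _ hP.quotientShift).comp
    (AddMonoidAlgebra.mapDomainRingHom _
      (DistribSMul.toAddMonoidHom ((Fin n → ℤ[X]) ⧸ N) (X : ℤ[X])))

theorem gradedShift_single (hP : IsReflexivePrime (shift σ n) P) (m : (Fin n → ℤ[X]) ⧸ N)
    (a : LaurentRing F n ⧸ P) :
    gradedShift hP N (AddMonoidAlgebra.single m a) =
      AddMonoidAlgebra.single ((X : ℤ[X]) • m) (hP.quotientShift a) := by
  simp [gradedShift]

theorem quotientShift_mk (hP : IsReflexivePrime (shift σ n) P) (p : LaurentRing F n) :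
    hP.quotientShift (Ideal.Quotient.mk P p) = Ideal.Quotient.mk P (shift σ n p) :=
  rfl

theorem gradedShift_gradedClass (hP : IsReflexivePrime (shift σ n) P) (p : LaurentRing F n) :
    gradedShift hP N (gradedClass P N p) = gradedClass P N (shift σ n p) := by
  have h : (gradedShift hP N).comp (gradedClass P N : LaurentRing F n →+* _) =
      (gradedClass P N : LaurentRing F n →+* _).comp (shift σ n) := by
    refine AddMonoidAlgebra.ringHom_ext (fun c => ?_) (fun f => ?_)
    · change gradedShift hP N (gradedClass P N (algebraMap F _ c)) =
        gradedClass P N (shift σ n (algebraMap F _ c))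
      rw [shift_algebraMap, gradedClass_algebraMap, gradedClass_algebraMap]
      have := quotientShift_mk hP (algebraMap F _ c)
      rw [shift_algebraMap] at this
      rw [gradedShift_single, smul_zero]
      exact congrArg _ this
    · change gradedShift hP N (gradedClass P N (mono F f)) =
        gradedClass P N (shift σ n (mono F f))
      rw [shift_mono, gradedClass_mono, gradedClass_mono, ← shift_mono σ, ← quotientShift_mk hP,
        gradedShift_single, map_smul]
  exact RingHom.congr_fun h p

/-- Reflexivity of P gives injectivity on coefficients; absence of x-torsion modulo N gives it on
exponents. -/
theorem gradedShift_injective (hP : IsReflexivePrime (shift σ n) P) (hsat : IsSaturated N) :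
    Function.Injective (gradedShift hP N) :=
  (AddMonoidAlgebra.map_injective _ hP.quotientShift_injective).comp
    (AddMonoidAlgebra.mapDomain_injective hsat.X_smul_injective)

theorem isReflexivePrime_constPart (hP : IsReflexivePrime (shift σ n) P)
    (hN : ∀ f ∈ N, f ∈ supportLattice P) (hsat : IsSaturated N) :
    IsReflexivePrime (shift σ n) (constPart P N) where
  diff p hp := by
    rw [← ker_gradedClass hP.prime.ne_top hN, RingHom.mem_ker] at hp ⊢
    rw [← gradedShift_gradedClass hP, hp, map_zero]
  reflexive p hp := by
    rw [← ker_gradedClass hP.prime.ne_top hN, RingHom.mem_ker] at hp ⊢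
    rw [← gradedShift_gradedClass hP] at hp
    exact gradedShift_injective hP hsat (hp.trans (map_zero _).symm)
  prime := isPrime_constPart hP.prime hN hsat

theorem isLaurentBinomial_constPart (h : IsDiffIdeal (shift σ n) (constPart P N)) :
    IsLaurentBinomial σ (constPart P N) := by
  refine ⟨constBinomials P N, ?_, le_antisymm ?_ (diffSpan_le h Ideal.subset_span)⟩
  · rintro p ⟨f, -, c, rfl, -⟩
    refine ⟨1, -c, f, 0, ?_⟩
    rw [one_smul, mono_zero, neg_smul, ← Algebra.algebraMap_eq_smul_one, sub_eq_add_neg]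
  · exact Ideal.span_le.mpr (subset_diffSpan _)

theorem supportLattice_constPart (hP : P ≠ ⊤) (hN : ∀ f ∈ N, f ∈ supportLattice P) :
    supportLattice (constPart P N) = N := by
  ext f
  constructor
  · rintro ⟨c, hc, h⟩
    rw [← ker_gradedClass hP hN, RingHom.mem_ker, map_sub, gradedClass_mono,
      gradedClass_algebraMap, sub_eq_zero] at h
    by_contra hf
    have hf0 : N.mkQ f ≠ 0 := by simpa using hf
    have h2 := congrArg (fun q => q.coeff (N.mkQ f)) h
    simp only [AddMonoidAlgebra.coeff_single, Finsupp.single_eq_same] at h2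
    rw [Finsupp.single_eq_of_ne hf0] at h2
    exact mono_notMem hP f (Ideal.Quotient.eq_zero_iff_mem.mp h2)
  · intro hf
    obtain ⟨c, hc, h⟩ := hN f hf
    exact ⟨c, hc, Ideal.subset_span ⟨f, hf, c, rfl, h⟩⟩

end ConstPart
-- The saturation is a saturated submodule.
section Saturation

variable {n : ℕ}

/-- The saturation of a submodule of `ℤ[x]^n`, as a submodule. -/
noncomputable def saturationSubmodule (L : Submodule ℤ[X] (Fin n → ℤ[X])) :
    Submodule ℤ[X] (Fin n → ℤ[X]) where
  carrier := saturation L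
  zero_mem' := ⟨1, one_ne_zero, 0, by simp⟩
  add_mem' := by
    rintro f g ⟨a, ha, k, hf⟩ ⟨b, hb, l, hg⟩
    refine ⟨a * b, mul_ne_zero ha hb, k + l, ?_⟩
    have h : (C (a * b) * X ^ (k + l) : ℤ[X]) • (f + g) =
        (C b * X ^ l : ℤ[X]) • (C a * X ^ k : ℤ[X]) • f +
          (C a * X ^ k : ℤ[X]) • (C b * X ^ l : ℤ[X]) • g := by
      simp only [smul_smul, smul_add, C_mul, pow_add]
      congr 2 <;> ring
    rw [h]
    exact L.add_mem (L.smul_mem _ hf) (L.smul_mem _ hg)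
  smul_mem' := by
    rintro p f ⟨a, ha, k, hf⟩
    refine ⟨a, ha, k, ?_⟩
    rw [smul_comm]
    exact L.smul_mem p hf

theorem exists_nsmul_mem_of_mem_saturation {L : Submodule ℤ[X] (Fin n → ℤ[X])}
    {f : Fin n → ℤ[X]} (hf : f ∈ saturationSubmodule L) :
    ∃ (m k : ℕ), m ≠ 0 ∧ m • (X ^ k : ℤ[X]) • f ∈ L := by
  obtain ⟨a, ha, k, h⟩ := hf
  have h1 : a • (X ^ k : ℤ[X]) • f ∈ L := by
    rwa [mul_smul, eq_intCast (C : ℤ →+* ℤ[X]), Int.cast_smul_eq_zsmul] at h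
  refine ⟨a.natAbs, k, Int.natAbs_ne_zero.mpr ha, ?_⟩
  rw [← natCast_zsmul]
  rcases Int.natAbs_eq a with h2 | h2
  · rwa [← h2]
  · rw [h2, neg_smul] at h1
    simpa using L.neg_mem h1

theorem isSaturated_saturationSubmodule (L : Submodule ℤ[X] (Fin n → ℤ[X])) :
    IsSaturated (saturationSubmodule L) where
  of_nsmul m f hm h := by
    obtain ⟨a, ha, k, h⟩ := h
    refine ⟨a * m, mul_ne_zero ha (by exact_mod_cast hm), k, ?_⟩
    rwa [← Nat.cast_smul_eq_nsmul ℤ[X], smul_smul, show (C a * X ^ k : ℤ[X]) * (m : ℤ[X]) =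
      C (a * m) * X ^ k by simp; ring] at h
  of_X_smul f h := by
    obtain ⟨a, ha, k, h⟩ := h
    refine ⟨a, ha, k + 1, ?_⟩
    rwa [smul_smul, mul_assoc, ← pow_succ] at h

end Saturation

/-! ### Binomial primes over I: existence, finiteness, and components. -/

section Components

variable {F : Type*} [Field F] {n : ℕ} {σ : F →+* F}

theorem exists_algebraMap_eq_of_pow_eq [IsAlgClosed F] {B : Type*} [CommRing B] [IsDomain B]
    [Algebra F B] {x : B} {m : ℕ} (hm : m ≠ 0) {d : F} (h : x ^ m = algebraMap F B d) :
    ∃ c, algebraMap F B c = x := by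
  have hx : IsIntegral F x := (h ▸ isIntegral_algebraMap).of_pow (Nat.pos_of_ne_zero hm)
  exact minpoly.mem_range_of_degree_eq_one F x
    (IsAlgClosed.degree_eq_one_of_irreducible F (minpoly.irreducible hx))

theorem supportLattice_mono {I J : Ideal (LaurentRing F n)} (h : I ≤ J) :
    supportLattice I ⊆ supportLattice J :=
  fun _ ⟨c, hc, hf⟩ => ⟨c, hc, h hf⟩

theorem saturation_subset_supportLattice [IsAlgClosed F] (hσ : Function.Bijective σ)
    {I P : Ideal (LaurentRing F n)} (hI : IsDiffIdeal (shift σ n) I)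
    (hP : IsReflexivePrime (shift σ n) P) (hIP : I ≤ P) {f : Fin n → ℤ[X]}
    (hf : f ∈ saturationSubmodule (supportSubmodule hI)) : f ∈ supportLattice P := by
  have := hP.prime
  obtain ⟨m, k, hm, h⟩ := exists_nsmul_mem_of_mem_saturation hf
  obtain ⟨d, -, h⟩ := mem_supportLattice.mp (supportLattice_mono hIP h)
  rw [mono_nsmul, map_pow] at h
  obtain ⟨e, he⟩ := exists_algebraMap_eq_of_pow_eq hm h
  -- Writing e = σ^k(c) turns the binomial into a k-th transform, which reflexivity can undo.
  obtain ⟨c, rfl⟩ := hσ.surjective.iterate k e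
  have h1 := mono_sub_mem_iff.mpr he.symm
  rw [← iterate_shift_mono σ, ← iterate_shift_algebraMap, ← iterate_map_sub] at h1
  have h2 := hP.iterate_mem h1
  exact ⟨c, ne_zero_of_mono_sub_mem hP.prime.ne_top h2, h2⟩

/-- A nonzero single term is a unit and cannot lie in the proper ideal P; two terms a Y^g + b Y^h
equal the unit a Y^h times Y^(g-h) + b/a. -/
theorem mem_constPart_of_isBinomial {I P : Ideal (LaurentRing F n)}
    {N : Submodule ℤ[X] (Fin n → ℤ[X])} (hP : P ≠ ⊤) (hIP : I ≤ P)
    (hN : supportLattice I ⊆ N) {p : LaurentRing F n} (hp : IsBinomial p) (hpI : p ∈ I) :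
    p ∈ constPart P N := by
  obtain ⟨a, b, g, h, rfl⟩ := hp
  have unit_smul : ∀ {J : Ideal (LaurentRing F n)} {c : F} {q : LaurentRing F n}, c ≠ 0 →
      c • q ∈ J → q ∈ J := by
    intro J c q hc hq
    rw [Algebra.smul_def] at hq
    exact (J.unit_mul_mem_iff_mem ((Ne.isUnit hc).map _)).mp hq
  by_cases ha : a = 0
  · by_cases hb : b = 0
    · simp [ha, hb]
    · rw [ha, zero_smul, zero_add] at hpI
      exact absurd (hIP (unit_smul hb hpI)) (mono_notMem hP h)
  by_cases hb : b = 0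
  · rw [hb, zero_smul, add_zero] at hpI
    exact absurd (hIP (unit_smul ha hpI)) (mono_notMem hP g)
  have hc : -(b / a) ≠ 0 := neg_ne_zero.mpr (div_ne_zero hb ha)
  have key : a • mono F g + b • mono F h = (algebraMap F _ a * mono F h) *
      (mono F (g - h) - algebraMap F (LaurentRing F n) (-(b / a))) := by
    have h1 : mono F g = mono F h * mono F (g - h) := by rw [← mono_add, add_sub_cancel]
    have h2 : algebraMap F (LaurentRing F n) b = algebraMap F _ a * algebraMap F _ (b / a) := by
      rw [← map_mul, mul_div_cancel₀ _ ha]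
    rw [Algebra.smul_def, Algebra.smul_def, h1, h2, map_neg]
    ring
  have hmem : mono F (g - h) - algebraMap F (LaurentRing F n) (-(b / a)) ∈ I := by
    rw [key] at hpI
    exact (I.unit_mul_mem_iff_mem (((Ne.isUnit ha).map _).mul (isUnit_mono h))).mp hpI
  rw [key]
  exact Ideal.mul_mem_left _ _ (Ideal.subset_span ⟨_, hN ⟨_, hc, hmem⟩, _, rfl, hIP hmem⟩)

theorem IsLaurentBinomial.isDiffIdeal {I : Ideal (LaurentRing F n)}
    (hI : IsLaurentBinomial σ I) : IsDiffIdeal (shift σ n) I := by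
  obtain ⟨B, -, rfl⟩ := hI
  exact isDiffIdeal_diffSpan _ B

theorem IsLaurentBinomial.le_constPart {I P : Ideal (LaurentRing F n)}
    (hI : IsLaurentBinomial σ I) {N : Submodule ℤ[X] (Fin n → ℤ[X])} (hP : P ≠ ⊤) (hIP : I ≤ P)
    (hN : supportLattice I ⊆ N) (hdiff : IsDiffIdeal (shift σ n) (constPart P N)) :
    I ≤ constPart P N := by
  obtain ⟨B, hB, rfl⟩ := hI
  exact diffSpan_le hdiff fun p hp =>
    mem_constPart_of_isBinomial hP hIP hN (hB p hp) (subset_diffSpan B hp)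

theorem supportSubmodule_le_saturation (L : Submodule ℤ[X] (Fin n → ℤ[X])) :
    L ≤ saturationSubmodule L :=
  fun f hf => ⟨1, one_ne_zero, 0, by simpa using hf⟩

variable (σ) in
/-- The reflexive prime `σ`-ideals containing `I` that are generated by binomials with exponents
in the saturation of the support lattice of `I`. -/
def binomialPrimes (I : Ideal (LaurentRing F n)) (hI : IsDiffIdeal (shift σ n) I) :
    Set (Ideal (LaurentRing F n)) :=
  {P | IsReflexivePrime (shift σ n) P ∧ I ≤ P ∧
    constPart P (saturationSubmodule (supportSubmodule hI)) = P}

theorem constPart_constPart (P : Ideal (LaurentRing F n))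
    (N : Submodule ℤ[X] (Fin n → ℤ[X])) : constPart (constPart P N) N = constPart P N := by
  refine le_antisymm (constPart_le _ _) (Ideal.span_mono ?_)
  rintro p ⟨f, hf, c, rfl, hp⟩
  exact ⟨f, hf, c, rfl, Ideal.subset_span ⟨f, hf, c, rfl, hp⟩⟩

theorem constPart_mem_binomialPrimes [IsAlgClosed F] (hσ : Function.Bijective σ)
    {I P : Ideal (LaurentRing F n)} (hI : IsLaurentBinomial σ I)
    (hP : IsReflexivePrime (shift σ n) P) (hIP : I ≤ P) :
    constPart P (saturationSubmodule (supportSubmodule hI.isDiffIdeal)) ∈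
      binomialPrimes σ I hI.isDiffIdeal := by
  have h := isReflexivePrime_constPart hP
    (fun f hf => saturation_subset_supportLattice hσ hI.isDiffIdeal hP hIP hf)
    (isSaturated_saturationSubmodule _)
  exact ⟨h, hI.le_constPart hP.prime.ne_top hIP
    (supportSubmodule_le_saturation (supportSubmodule hI.isDiffIdeal)) h.diff,
    constPart_constPart _ _⟩

theorem supportLattice_of_mem_binomialPrimes [IsAlgClosed F] (hσ : Function.Bijective σ)
    {I P : Ideal (LaurentRing F n)} {hI : IsDiffIdeal (shift σ n) I}
    (hP : P ∈ binomialPrimes σ I hI) :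
    supportLattice P = saturation (supportLattice I) := by
  have h := supportLattice_constPart hP.1.prime.ne_top
    (fun f hf => saturation_subset_supportLattice hσ hI hP.1 hP.2.1 hf)
  rw [hP.2.2] at h
  exact h

theorem perfectClosure_eq_sInf_binomialPrimes [IsAlgClosed F] (hσ : Function.Bijective σ)
    {I : Ideal (LaurentRing F n)} (hI : IsLaurentBinomial σ I) :
    perfectClosure (shift σ n) I = sInf (binomialPrimes σ I hI.isDiffIdeal) := by
  rw [perfectClosure_eq_sInf]
  refine le_antisymm (sInf_le_sInf fun P hP => ⟨hP.1, hP.2.1⟩) (le_sInf fun P hP => ?_)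
  exact (sInf_le (constPart_mem_binomialPrimes hσ hI hP.1 hP.2)).trans (constPart_le _ _)

theorem IsComponent.mem_binomialPrimes [IsAlgClosed F] (hσ : Function.Bijective σ)
    {I P : Ideal (LaurentRing F n)} (hI : IsLaurentBinomial σ I)
    (hP : IsComponent (shift σ n) I P) : P ∈ binomialPrimes σ I hI.isDiffIdeal := by
  have h := constPart_mem_binomialPrimes hσ hI hP.prop.1 hP.prop.2
  rwa [le_antisymm (constPart_le _ _) (hP.le_of_le ⟨h.1, h.2.1⟩ (constPart_le _ _))] at h

/-- The integers m, k and the constant d come from I alone, and every c that occurs satisfies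
σ^k(c)^m = d. -/
theorem finite_setOf_mono_sub_mem {I : Ideal (LaurentRing F n)}
    {hI : IsDiffIdeal (shift σ n) I} {f : Fin n → ℤ[X]}
    (hf : f ∈ saturationSubmodule (supportSubmodule hI)) :
    {c : F | ∃ P ∈ binomialPrimes σ I hI, mono F f - algebraMap F _ c ∈ P}.Finite := by
  obtain ⟨m, k, hm, d, -, hd⟩ := exists_nsmul_mem_of_mem_saturation hf
  have hfin : {c : F | c ^ m = d}.Finite := by
    refine (Polynomial.finite_setOfPred_isRoot
      (Polynomial.X_pow_sub_C_ne_zero (Nat.pos_of_ne_zero hm) d)).subset fun c hc => ?_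
    simpa [sub_eq_zero] using hc
  refine (hfin.preimage (σ.injective.iterate k).injOn).subset ?_
  rintro c ⟨P, hP, h⟩
  have h1 := hP.1.diff.iterate_mem h k
  rw [iterate_map_sub, iterate_shift_mono, iterate_shift_algebraMap] at h1
  refine eq_of_mono_sub_mem hP.1.prime.ne_top ?_ (hP.2.1 hd)
  rw [mono_sub_mem_iff] at h1 ⊢
  rw [mono_nsmul, map_pow, h1, map_pow]

theorem finite_binomialPrimes [IsAlgClosed F] (hσ : Function.Bijective σ)
    {I : Ideal (LaurentRing F n)} (hI : IsDiffIdeal (shift σ n) I) :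
    (binomialPrimes σ I hI).Finite := by
  classical
  set N := saturationSubmodule (supportSubmodule hI) with hNdef
  obtain ⟨G, hG⟩ := IsNoetherian.noetherian N
  have hGN : ∀ g ∈ G, g ∈ N := fun g hg => hG ▸ Submodule.subset_span hg
  have hval : ∀ P ∈ binomialPrimes σ I hI, ∀ g : G,
      ∃ c : F, mono F g.1 - algebraMap F (LaurentRing F n) c ∈ P := fun P hP g => by
    obtain ⟨c, -, h⟩ := saturation_subset_supportLattice hσ hI hP.1 hP.2.1 (hGN g.1 g.2)
    exact ⟨c, h⟩
  choose! v hv using hval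
  refine Set.Finite.of_finite_image (f := v) ?_ ?_
  · refine (Set.Finite.pi' fun g : G => finite_setOf_mono_sub_mem (hGN g.1 g.2)).subset ?_
    rintro _ ⟨P, hP, rfl⟩ g
    exact ⟨P, hP, hv P hP g⟩
  · have key : ∀ P ∈ binomialPrimes σ I hI, ∀ Q ∈ binomialPrimes σ I hI, v P = v Q → P ≤ Q := by
      intro P hP Q hQ hPQ
      have hdiff : IsDiffIdeal (shift σ n) (P ⊓ Q) :=
        fun p hp => ⟨hP.1.diff p hp.1, hQ.1.diff p hp.2⟩
      -- The support lattice of P ⊓ Q consists of the exponents at which P and Q have a common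
      -- constant. It is a submodule, so agreement on generators of N extends to N.
      have hle : N ≤ supportSubmodule hdiff := by
        rw [← hG, Submodule.span_le]
        intro g hg
        have h1 := hv P hP ⟨g, hg⟩
        have h2 := hv Q hQ ⟨g, hg⟩
        rw [← hPQ] at h2
        exact ⟨_, ne_zero_of_mono_sub_mem hP.1.prime.ne_top h1, h1, h2⟩
      rw [← hP.2.2, constPart, Ideal.span_le]
      rintro p ⟨f, hf, c, rfl, hp⟩
      obtain ⟨d, -, hdP, hdQ⟩ := hle hf
      rwa [eq_of_mono_sub_mem hP.1.prime.ne_top hp hdP]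
    exact fun P hP Q hQ h => le_antisymm (key P hP Q hQ h) (key Q hQ P hP h.symm)

end Components
-- Algebraic independence of monomials from linear independence of exponents.
section IndependentMonomials

/-- Independence of the exponents over ℕ sends distinct monomials in the variables to distinct basis
elements with unit coefficients, so nothing cancels. -/
theorem algebraicIndependent_single {F B M ι : Type*} [Field F] [CommRing B] [Nontrivial B]
    [Algebra F B] [AddCommMonoid M] {u : ι → M} (hu : LinearIndependent ℕ u) {b : ι → B}
    (hb : ∀ i, IsUnit (b i)) :
    AlgebraicIndependent F (fun i => AddMonoidAlgebra.single (u i) (b i)) := by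
  classical
  rw [algebraicIndependent_iff]
  intro p hp
  have hprod : ∀ d : ι →₀ ℕ, ∏ i ∈ d.support, AddMonoidAlgebra.single (u i) (b i) ^ d i =
      AddMonoidAlgebra.single (Finsupp.linearCombination ℕ u d) (∏ i ∈ d.support, b i ^ d i) := by
    intro d
    simp_rw [AddMonoidAlgebra.single_pow, Finsupp.linearCombination_apply, Finsupp.sum]
    induction d.support using Finset.induction_on with
    | empty => simp [AddMonoidAlgebra.one_def]
    | insert i s hi ih => rw [Finset.prod_insert hi, ih, AddMonoidAlgebra.single_mul_single,
        Finset.sum_insert hi, Finset.prod_insert hi]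
  rw [MvPolynomial.aeval_def, MvPolynomial.eval₂_eq] at hp
  ext d
  simp_rw [hprod, ← Algebra.smul_def, AddMonoidAlgebra.smul_single] at hp
  have h := congrArg (fun q => q.coeff (Finsupp.linearCombination ℕ u d)) hp
  simp only [AddMonoidAlgebra.coeff_sum, Finsupp.finsetSum_apply, AddMonoidAlgebra.coeff_single,
    Finsupp.single_apply, (show Function.Injective (Finsupp.linearCombination ℕ u) from hu).eq_iff,
    AddMonoidAlgebra.coeff_zero, Finsupp.coe_zero, Pi.zero_apply, Finset.sum_ite_eq'] at h
  rw [MvPolynomial.coeff_zero]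
  by_contra hne
  rw [if_pos (MvPolynomial.mem_support_iff.mpr hne), Algebra.smul_def] at h
  exact (((Ne.isUnit hne).map (algebraMap F B)).mul
    (Finset.prod_induction _ IsUnit (fun _ _ => IsUnit.mul) isUnit_one
      fun i _ => (hb i).pow _)).ne_zero h

theorem eq_zero_of_map_aeval_eq_zero {F R B M ι : Type*} [Field F] [CommRing R] [CommRing B]
    [Nontrivial B] [Algebra F R] [Algebra F B] [AddCommMonoid M] {u : ι → M}
    (hu : LinearIndependent ℕ u) {b : ι → B} (hb : ∀ i, IsUnit (b i)) {x : ι → R}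
    (φ : R →ₐ[F] AddMonoidAlgebra B M) (hφ : ∀ i, φ (x i) = AddMonoidAlgebra.single (u i) (b i))
    {p : MvPolynomial ι F} (hp : φ (MvPolynomial.aeval x p) = 0) : p = 0 := by
  rw [MvPolynomial.comp_aeval_apply] at hp
  simp_rw [hφ] at hp
  exact algebraicIndependent_iff.mp (algebraicIndependent_single hu hb) p hp

theorem linearIndependent_X_pow_smul {M ι : Type*} [AddCommGroup M] [Module ℤ[X] M] {v : ι → M}
    (hv : LinearIndependent ℤ[X] v) :
    LinearIndependent ℕ (fun q : ι × ℕ => (X ^ q.2 : ℤ[X]) • v q.1) := by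
  have h1 : LinearIndependent ℤ (fun k : ℕ => (X ^ k : ℤ[X])) := by
    simpa [Polynomial.coe_basisMonomials, ← Polynomial.X_pow_eq_monomial] using
      (Polynomial.basisMonomials ℤ).linearIndependent
  exact ((linearIndependent_smul h1 hv).restrict_scalars' ℕ).comp Prod.swap Prod.swap_injective

end IndependentMonomials

/-! ### Monomials in the fraction field of the residue ring. -/

section FractionField

variable {F : Type*} [Field F] {n : ℕ} {σ : F →+* F} {P : Ideal (LaurentRing F n)}

/-- The image of a Laurent `σ`-polynomial in the field of fractions of the residue ring. -/
noncomputable def toFraction (P : Ideal (LaurentRing F n)) :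
    LaurentRing F n →ₐ[F] FractionRing (LaurentRing F n ⧸ P) :=
  (IsScalarTower.toAlgHom F (LaurentRing F n ⧸ P) _).comp (Ideal.Quotient.mkₐ F P)

theorem toFraction_apply (p : LaurentRing F n) :
    toFraction P p = algebraMap _ (FractionRing (LaurentRing F n ⧸ P)) (Ideal.Quotient.mk P p) :=
  rfl

theorem toFraction_eq_zero_iff {p : LaurentRing F n} : toFraction P p = 0 ↔ p ∈ P := by
  rw [toFraction_apply, ← Ideal.Quotient.eq_zero_iff_mem]
  exact (IsFractionRing.injective (LaurentRing F n ⧸ P) _).eq_iff' (map_zero _)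

theorem fractionShift_toFraction (hP : IsReflexivePrime (shift σ n) P) (p : LaurentRing F n) :
    hP.fractionShift (toFraction P p) = toFraction P (shift σ n p) := by
  have := hP.prime
  simp only [toFraction_apply, IsReflexivePrime.fractionShift]
  rw [IsFractionRing.map, IsLocalization.map_eq]
  rfl

theorem iterate_fractionShift_toFraction (hP : IsReflexivePrime (shift σ n) P)
    (p : LaurentRing F n) (k : ℕ) :
    hP.fractionShift^[k] (toFraction P p) = toFraction P ((shift σ n)^[k] p) := by
  induction k with
  | zero => rfl
  | succ k ih => rw [Function.iterate_succ_apply', ih, fractionShift_toFraction,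
      Function.iterate_succ_apply']

theorem algebraicIndependent_toFraction_mono {N : Submodule ℤ[X] (Fin n → ℤ[X])} (hP : P.IsPrime)
    (hker : RingHom.ker (gradedClass P N) = P) {ι : Type*} {g : ι → Fin n → ℤ[X]}
    (hg : LinearIndependent ℕ (fun i => N.mkQ (g i))) :
    AlgebraicIndependent F (fun i => toFraction P (mono F (g i))) := by
  rw [algebraicIndependent_iff]
  intro p hp
  have hb : ∀ i, IsUnit (Ideal.Quotient.mk P (mono F (g i))) :=
    fun i => (isUnit_mono (g i)).map _
  rw [← MvPolynomial.comp_aeval_apply (fun i => mono F (g i)) (toFraction P),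
    toFraction_eq_zero_iff, ← hker, RingHom.mem_ker] at hp
  exact eq_zero_of_map_aeval_eq_zero hg hb (gradedClass P N) (fun i => gradedClass_mono (g i)) hp

end FractionField

/-! ### Growth of ℤ[x]-modules modulo N. -/

section Counting

variable {M : Type*} [AddCommGroup M] [Module ℤ[X] M]

theorem exists_sum_smul_sub_mem {ι : Type*} [Fintype ι] {N : Submodule ℤ[X] M} {e : ι → M}
    {s : Finset ι} {a : ℤ[X]} {i : ι}
    (h : a • N.mkQ (e i) ∈ Submodule.span ℤ[X] ((fun j => N.mkQ (e j)) '' (s : Set ι))) :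
    ∃ c : ι → ℤ[X], a • e i - ∑ j ∈ s, c j • e j ∈ N := by
  classical
  obtain ⟨l, hl, h⟩ := (Finsupp.mem_span_image_iff_linearCombination ℤ[X]).mp h
  refine ⟨l, ?_⟩
  rw [← Submodule.Quotient.mk_eq_zero, ← Submodule.mkQ_apply, map_sub, map_smul, map_sum,
    sub_eq_zero, ← h, Finsupp.linearCombination_apply,
    Finsupp.sum_of_support_subset l (by simpa [Finsupp.mem_supported] using hl) _ (by simp)]
  simp only [map_smul]

theorem smul_mem_of_natDegree_lt {G : AddSubgroup M} {m : M} {T : ℕ}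
    (h : ∀ l < T, (X ^ l : ℤ[X]) • m ∈ G) {p : ℤ[X]} (hp : p.natDegree < T) : p • m ∈ G := by
  rw [p.as_sum_range_C_mul_X_pow' hp, Finset.sum_smul]
  refine G.sum_mem fun k hk => ?_
  rw [mul_smul, eq_intCast (C : ℤ →+* ℤ[X]), Int.cast_smul_eq_zsmul]
  exact G.zsmul_mem (h k (Finset.mem_range.mp hk)) _

/-- Take s maximal independent modulo N. Each i outside s has a relation a_i e_i ≡ ∑ c_ij e_j; its
multiples by x^k express the leading coefficient times a high transform of e_i through lower
transforms and those of s. The division-closed group G absorbs the leading coefficient. Here d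
bounds the degrees of the a_i and D those of the c_ij. -/
theorem exists_linearIndependent_growth {ι : Type*} [Fintype ι] (N : Submodule ℤ[X] M)
    (e : ι → M) :
    ∃ s : Finset ι, LinearIndependent ℤ[X] (fun j : s => N.mkQ (e j)) ∧
      ∃ d D : ℕ, ∀ (T : ℕ) (G : AddSubgroup M), (∀ f ∈ N, f ∈ G) →
        (∀ (m : ℕ) (f : M), m ≠ 0 → m • f ∈ G → f ∈ G) →
        (∀ j, ∀ l < d, (X ^ l : ℤ[X]) • e j ∈ G) →
        (∀ j ∈ s, ∀ l < T + D, (X ^ l : ℤ[X]) • e j ∈ G) →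
        ∀ j, ∀ l < T, (X ^ l : ℤ[X]) • e j ∈ G := by
  classical
  obtain ⟨s, hs, hmax⟩ := exists_maximal_linearIndepOn ℤ[X] (fun j => N.mkQ (e j))
  lift s to Finset ι using s.toFinite
  have hrel : ∀ i, ∃ a : ℤ[X], ∃ c : ι → ℤ[X], i ∉ s →
      a ≠ 0 ∧ a • e i - ∑ j ∈ s, c j • e j ∈ N := by
    intro i
    by_cases hi : i ∈ s
    · exact ⟨0, 0, fun h => absurd hi h⟩
    · obtain ⟨a, ha, h⟩ := hmax i hi
      obtain ⟨c, hc⟩ := exists_sum_smul_sub_mem h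
      exact ⟨a, c, fun _ => ⟨ha, hc⟩⟩
  choose a c hac using hrel
  refine ⟨s, hs, ∑ i, (a i).natDegree, ∑ i, ∑ j, (c i j).natDegree,
    fun T G hNG hsat hd hD i l hl => ?_⟩
  have hdeg : (a i).natDegree ≤ ∑ i, (a i).natDegree :=
    Finset.single_le_sum (f := fun i => (a i).natDegree) (fun _ _ => Nat.zero_le _)
      (Finset.mem_univ i)
  have hdeg' : ∀ j, (c i j).natDegree ≤ ∑ i, ∑ j, (c i j).natDegree := fun j =>
    (Finset.single_le_sum (f := fun j => (c i j).natDegree) (fun _ _ => Nat.zero_le _)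
      (Finset.mem_univ j)).trans
      (Finset.single_le_sum (f := fun i => ∑ j, (c i j).natDegree) (fun _ _ => Nat.zero_le _)
        (Finset.mem_univ i))
  induction l using Nat.strong_induction_on with
  | _ l ih =>
  by_cases hi : i ∈ s
  · exact hD i hi l (by omega)
  by_cases hld : l < (a i).natDegree
  · exact hd i l (by omega)
  push Not at hld
  obtain ⟨k, rfl⟩ := Nat.exists_eq_add_of_le hld
  obtain ⟨ha, hmem⟩ := hac i hi
  have h1 : ((X ^ k : ℤ[X]) * a i) • e i ∈ G := by
    have h2 : (X ^ k : ℤ[X]) • ∑ j ∈ s, c i j • e j ∈ G := by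
      rw [Finset.smul_sum]
      refine G.sum_mem fun j hj => ?_
      rw [smul_smul]
      refine smul_mem_of_natDegree_lt (hD j hj) ?_
      have h3 := natDegree_mul_le (p := (X ^ k : ℤ[X])) (q := c i j)
      rw [natDegree_X_pow] at h3
      have := hdeg' j
      omega
    have h4 := G.add_mem (hNG _ (N.smul_mem (X ^ k : ℤ[X]) hmem)) h2
    rwa [smul_sub, sub_add_cancel, smul_smul] at h4
  have h2 : ((X ^ k : ℤ[X]) * (a i).eraseLead) • e i ∈ G := by
    -- In degree 0 erasing the leading term leaves 0, whose `natDegree` does not drop, so this case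
    -- is separate.
    rcases Nat.eq_zero_or_pos (a i).natDegree with h0 | h0
    · rw [eq_C_of_natDegree_eq_zero h0, eraseLead_C, mul_zero, zero_smul]
      exact G.zero_mem
    · refine smul_mem_of_natDegree_lt (T := (a i).natDegree + k)
        (fun l' hl' => ih l' hl' (by omega)) ?_
      have h3 := natDegree_mul_le (p := (X ^ k : ℤ[X])) (q := (a i).eraseLead)
      rw [natDegree_X_pow] at h3
      have := eraseLead_natDegree_le (a i)
      omega
  have h3 : (a i).leadingCoeff • (X ^ ((a i).natDegree + k) : ℤ[X]) • e i ∈ G := by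
    have h4 := G.sub_mem h1 h2
    rw [← sub_smul, ← mul_sub, sub_eq_of_eq_add' (eraseLead_add_C_mul_X_pow (a i)).symm] at h4
    rw [← Int.cast_smul_eq_zsmul ℤ[X], ← eq_intCast (C : ℤ →+* ℤ[X]), smul_smul]
    convert h4 using 2
    ring
  refine hsat (a i).leadingCoeff.natAbs _ (by simpa using ha) ?_
  rw [← natCast_zsmul]
  rcases Int.natAbs_eq (a i).leadingCoeff with h4 | h4
  · rwa [← h4]
  · rw [h4, neg_smul] at h3
    simpa using h3

end Counting

/-! ### Transcendence rank and relative algebraic closure. -/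

section Matroid

variable {F K : Type*} [Field F] [Field K] [Algebra F K]

/-- The first T transforms of the elements of t are |t|T distinct independent elements of the
closure of W, whose rank is at most |W|. -/
theorem SigmaIndependent.card_mul_le {τ : K →+* K} {S : Set K} (hS : SigmaIndependent F τ S)
    {t W : Finset K} (htS : (t : Set K) ⊆ S) (T : ℕ)
    (h : ∀ a ∈ t, ∀ k < T, τ^[k] a ∈ (AlgebraicIndependent.matroid F K).closure W) :
    t.card * T ≤ W.card := by
  classical
  set v : S × ℕ → K := fun q => τ^[q.2] (q.1 : K) with hv
  have hinj : Function.Injective v := AlgebraicIndependent.injective hS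
  have hind : (AlgebraicIndependent.matroid F K).Indep (Set.range v) :=
    AlgebraicIndependent.matroid_indep_iff.mpr (AlgebraicIndependent.coe_range hS)
  set A : Finset (S × ℕ) := (t.subtype (· ∈ S)) ×ˢ Finset.range T with hA
  have hcard : A.card = t.card * T := by
    rw [hA, Finset.card_product, Finset.card_range, Finset.card_subtype,
      Finset.filter_true_of_mem fun a ha => htS ha]
  have hsub : v '' (A : Set (S × ℕ)) ⊆ (AlgebraicIndependent.matroid F K).closure W := by
    rintro _ ⟨q, hq, rfl⟩
    simp only [hA, Finset.coe_product, Set.mem_prod, Finset.mem_coe, Finset.mem_subtype,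
      Finset.mem_range] at hq
    exact h _ hq.1 _ hq.2
  have h1 := (hind.subset (Set.image_subset_range v A)).encard_le_eRk_of_subset hsub
  rw [Matroid.eRk_closure_eq, hinj.encard_image] at h1
  have h2 := h1.trans (Matroid.eRk_le_encard _ _)
  rw [Set.encard_coe_eq_coe_finsetCard, Set.encard_coe_eq_coe_finsetCard, hcard] at h2
  exact_mod_cast h2

end Matroid
section Closure

variable {F K : Type*} [Field F] [Field K] [Algebra F K] {W : Set K}

variable (F W) in
/-- The elements of `K` that are algebraic over `F(W)`. -/
noncomputable def algClosureIn : Set K :=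
  (AlgebraicIndependent.matroid F K).closure W

theorem mem_algClosureIn {a : K} :
    a ∈ algClosureIn F W ↔
      a ∈ Subalgebra.algebraicClosure (Algebra.adjoin F W) K := by
  rw [algClosureIn, AlgebraicIndependent.matroid_closure_eq, SetLike.mem_coe]

theorem mul_mem_algClosureIn {a b : K}
    (ha : a ∈ algClosureIn F W)
    (hb : b ∈ algClosureIn F W) :
    a * b ∈ algClosureIn F W := by
  rw [mem_algClosureIn] at *
  exact mul_mem ha hb

theorem add_mem_algClosureIn {a b : K}
    (ha : a ∈ algClosureIn F W)
    (hb : b ∈ algClosureIn F W) :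
    a + b ∈ algClosureIn F W := by
  rw [mem_algClosureIn] at *
  exact add_mem ha hb

theorem algebraMap_mem_algClosureIn (c : F) :
    algebraMap F K c ∈ algClosureIn F W := by
  rw [mem_algClosureIn, IsScalarTower.algebraMap_apply F (Algebra.adjoin F W) K]
  exact Subalgebra.algebraMap_mem _ _

theorem inv_mem_algClosureIn {a : K}
    (ha : a ∈ algClosureIn F W) :
    a⁻¹ ∈ algClosureIn F W := by
  rw [mem_algClosureIn, Subalgebra.mem_algebraicClosure] at *
  exact ha.inv

theorem mem_algClosureIn_of_pow {a : K} {m : ℕ} (hm : m ≠ 0)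
    (ha : a ^ m ∈ algClosureIn F W) :
    a ∈ algClosureIn F W := by
  rw [mem_algClosureIn, Subalgebra.mem_algebraicClosure] at *
  exact ha.of_pow (Nat.pos_of_ne_zero hm)

theorem subset_algClosureIn : W ⊆ algClosureIn F W :=
  Matroid.subset_closure _ _ (Set.subset_univ _)

/-- The exponents `f` for which the value of a character `y` at `f` is algebraic over `W`. -/
noncomputable def algebraicExponents {A : Type*} [AddCommGroup A] (F : Type*) [Field F] [Algebra F K]
    (y : Multiplicative A →* K) (W : Set K) : AddSubgroup A where
  carrier := {f | y (Multiplicative.ofAdd f) ∈ algClosureIn F W}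
  zero_mem' := by
    change y 1 ∈ algClosureIn F W
    rw [map_one, ← map_one (algebraMap F K)]
    exact algebraMap_mem_algClosureIn 1
  add_mem' hf hg := by
    change y _ ∈ algClosureIn F W
    rw [ofAdd_add, map_mul]
    exact mul_mem_algClosureIn hf hg
  neg_mem' {f} hf := by
    change y _ ∈ algClosureIn F W
    have h : y (Multiplicative.ofAdd (-f)) = (y (Multiplicative.ofAdd f))⁻¹ := by
      apply eq_inv_of_mul_eq_one_left
      rw [← map_mul, ← ofAdd_add, neg_add_cancel, ofAdd_zero, map_one]
    rw [h]
    exact inv_mem_algClosureIn hf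

end Closure

theorem sigmaIndependent_range_of_algebraicIndependent {F K ι : Type*} [Field F] [CommRing K]
    [Nontrivial K] [Algebra F K] {τ : K →+* K} {v : ι → K}
    (h : AlgebraicIndependent F (fun q : ι × ℕ => τ^[q.2] (v q.1))) :
    Function.Injective v ∧ SigmaIndependent F τ (Set.range v) := by
  have hinj : Function.Injective v := fun i j hij =>
    congrArg Prod.fst (h.injective (a₁ := (i, 0)) (a₂ := (j, 0)) hij)
  refine ⟨hinj, ?_⟩
  have h2 := h.comp (Prod.map (Equiv.ofInjective v hinj).symm id)
    ((Equiv.injective _).prodMap Function.injective_id)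
  have h3 : (fun q : Set.range v × ℕ => τ^[q.2] (q.1 : K)) =
      (fun q : ι × ℕ => τ^[q.2] (v q.1)) ∘ Prod.map (Equiv.ofInjective v hinj).symm id := by
    ext ⟨a, k⟩
    simp [Equiv.apply_ofInjective_symm hinj]
  rwa [← h3] at h2

/-! ### Filtration by order. -/

section DegreeFiltration

variable {F : Type*} [Field F] {n : ℕ} {σ : F →+* F}

variable (F n) in
/-- The Laurent `σ`-polynomials whose exponents have coordinates of degree less than `T`. -/
noncomputable def degreeBounded (T : ℕ) : AddSubmonoid (LaurentRing F n) :=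
  AddSubmonoid.closure {p | ∃ (f : Fin n → ℤ[X]) (c : F), (∀ j, (f j).natDegree < T) ∧
    p = AddMonoidAlgebra.single f c}

theorem degreeBounded_mono {T T' : ℕ} (h : T ≤ T') : degreeBounded F n T ≤ degreeBounded F n T' := by
  refine AddSubmonoid.closure_mono ?_
  rintro p ⟨f, c, hf, rfl⟩
  exact ⟨f, c, fun j => (hf j).trans_le h, rfl⟩

theorem exists_mem_degreeBounded (p : LaurentRing F n) : ∃ T, p ∈ degreeBounded F n T := by
  induction p using AddMonoidAlgebra.induction_linear with
  | zero => exact ⟨0, zero_mem _⟩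
  | add p q hp hq =>
    obtain ⟨T, hT⟩ := hp
    obtain ⟨T', hT'⟩ := hq
    exact ⟨max T T', add_mem (degreeBounded_mono (le_max_left _ _) hT)
      (degreeBounded_mono (le_max_right _ _) hT')⟩
  | single f c =>
    refine ⟨∑ j, (f j).natDegree + 1, AddSubmonoid.subset_closure ⟨f, c, fun j => ?_, rfl⟩⟩
    exact Nat.lt_succ_of_le (Finset.single_le_sum (f := fun j => (f j).natDegree)
      (fun _ _ => Nat.zero_le _) (Finset.mem_univ j))

theorem shift_mem_degreeBounded {p : LaurentRing F n} {T : ℕ} (hp : p ∈ degreeBounded F n T) :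
    shift σ n p ∈ degreeBounded F n (T + 1) := by
  induction hp using AddSubmonoid.closure_induction with
  | mem p hp =>
    obtain ⟨f, c, hf, rfl⟩ := hp
    rw [shift_single]
    refine AddSubmonoid.subset_closure ⟨_, _, fun j => ?_, rfl⟩
    have h1 := natDegree_mul_le (p := (X : ℤ[X])) (q := f j)
    rw [natDegree_X] at h1
    have h2 := hf j
    rw [Pi.smul_apply, smul_eq_mul]
    omega
  | zero => rw [map_zero]; exact zero_mem _
  | add p q _ _ hp hq => rw [map_add]; exact add_mem hp hq

theorem iterate_shift_mem_degreeBounded {p : LaurentRing F n} {T : ℕ}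
    (hp : p ∈ degreeBounded F n T) (k : ℕ) :
    (shift σ n)^[k] p ∈ degreeBounded F n (T + k) := by
  induction k with
  | zero => exact hp
  | succ k ih => rw [Function.iterate_succ_apply']; exact shift_mem_degreeBounded ih

theorem exists_forall_mem_degreeBounded (t : Finset (LaurentRing F n)) :
    ∃ T, ∀ p ∈ t, p ∈ degreeBounded F n T := by
  choose T hT using exists_mem_degreeBounded (F := F) (n := n)
  exact ⟨∑ p ∈ t, T p, fun p hp => degreeBounded_mono
    (Finset.single_le_sum (f := T) (fun _ _ => Nat.zero_le _) hp) (hT p)⟩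

end DegreeFiltration

/-! ### The dimension depends only on N. -/

section Dimension

variable {F : Type*} [Field F] {n : ℕ} {σ : F →+* F} {P : Ideal (LaurentRing F n)}

/-- The character `f ↦ y ^ f` with values in the field of fractions of the residue ring. -/
noncomputable def genericCharacter (P : Ideal (LaurentRing F n)) :
    Multiplicative (Fin n → ℤ[X]) →* FractionRing (LaurentRing F n ⧸ P) where
  toFun f := toFraction P (mono F f.toAdd)
  map_one' := by rw [toAdd_one, mono_zero, map_one]
  map_mul' f g := by rw [toAdd_mul, mono_add, map_mul]

/-- The standard basis vectors of `ℤ[x]^n`. -/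
noncomputable def stdVec (n : ℕ) (j : Fin n) : Fin n → ℤ[X] :=
  Pi.single j 1

theorem mem_of_natDegree_lt {G : AddSubgroup (Fin n → ℤ[X])} {T : ℕ}
    (h : ∀ j, ∀ l < T, (X ^ l : ℤ[X]) • stdVec n j ∈ G) {f : Fin n → ℤ[X]}
    (hf : ∀ j, (f j).natDegree < T) : f ∈ G := by
  rw [pi_eq_sum_univ' f]
  exact G.sum_mem fun j _ => smul_mem_of_natDegree_lt (h j) (hf j)

theorem card_le_of_sigmaIndependent (hP : IsReflexivePrime (shift σ n) P)
    {N : Submodule ℤ[X] (Fin n → ℤ[X])} (hN : ∀ f ∈ N, f ∈ supportLattice P)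
    {s : Finset (Fin n)} {d D : ℕ}
    (hgrowth : ∀ (T : ℕ) (G : AddSubgroup (Fin n → ℤ[X])), (∀ f ∈ N, f ∈ G) →
      (∀ (m : ℕ) (f : Fin n → ℤ[X]), m ≠ 0 → m • f ∈ G → f ∈ G) →
      (∀ j, ∀ l < d, (X ^ l : ℤ[X]) • stdVec n j ∈ G) →
      (∀ j ∈ s, ∀ l < T + D, (X ^ l : ℤ[X]) • stdVec n j ∈ G) →
      ∀ j, ∀ l < T, (X ^ l : ℤ[X]) • stdVec n j ∈ G)
    {S : Set (FractionRing (LaurentRing F n ⧸ P))} (hS : SigmaIndependent F hP.fractionShift S)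
    {t : Finset (FractionRing (LaurentRing F n ⧸ P))} (ht : (t : Set _) ⊆ S) :
    t.card ≤ s.card := by
  classical
  have := hP.prime
  have hfrac : ∀ z : FractionRing (LaurentRing F n ⧸ P), ∃ a b : LaurentRing F n,
      z = toFraction P a / toFraction P b := by
    intro z
    obtain ⟨x, y, -, rfl⟩ := IsFractionRing.div_surjective (LaurentRing F n ⧸ P) z
    obtain ⟨a, rfl⟩ := Ideal.Quotient.mk_surjective x
    obtain ⟨b, rfl⟩ := Ideal.Quotient.mk_surjective y
    exact ⟨a, b, rfl⟩
  choose num den hnd using hfrac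
  obtain ⟨N₁, hN₁⟩ := exists_forall_mem_degreeBounded (t.image num ∪ t.image den)
  have key : ∀ T : ℕ, t.card * T ≤ n * d + s.card * (N₁ + T + D) := by
    intro T
    let y : Fin n × ℕ → FractionRing (LaurentRing F n ⧸ P) :=
      fun q => toFraction P (mono F ((X ^ q.2 : ℤ[X]) • stdVec n q.1))
    -- These monomials are the initial data of `hgrowth`: all variables up to order d, and those in
    -- s up to order N₁ + T + D. All monomials of order less than N₁ + T are then algebraic over W.
    let W : Finset (FractionRing (LaurentRing F n ⧸ P)) :=
      ((Finset.univ ×ˢ Finset.range d) ∪ (s ×ˢ Finset.range (N₁ + T + D))).image y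
    have hWcard : W.card ≤ n * d + s.card * (N₁ + T + D) := by
      refine Finset.card_image_le.trans ((Finset.card_union_le _ _).trans ?_)
      simp
    have hG := hgrowth (N₁ + T) (algebraicExponents F (genericCharacter P) (W : Set _))
      (fun f hf => by
        obtain ⟨c, -, hc⟩ := hN f hf
        have h1 : toFraction P (mono F f) = algebraMap F _ c := by
          rw [← sub_eq_zero, ← (toFraction P).commutes, ← map_sub, toFraction_eq_zero_iff]
          exact hc
        change toFraction P (mono F f) ∈ algClosureIn F (W : Set _)
        rw [h1]
        exact algebraMap_mem_algClosureIn c)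
      (fun m f hm hf => by
        change toFraction P (mono F (m • f)) ∈ algClosureIn F (W : Set _) at hf
       
        rw [mono_nsmul, map_pow] at hf
        exact mem_algClosureIn_of_pow hm hf)
      (fun j l hl => subset_algClosureIn (Finset.mem_coe.mpr (Finset.mem_image_of_mem y
        (a := (j, l)) (by simp [hl]))))
      (fun j hj l hl => subset_algClosureIn (Finset.mem_coe.mpr (Finset.mem_image_of_mem y
        (a := (j, l)) (by simp [hl, hj]))))
    have hbdd : ∀ p ∈ degreeBounded F n (N₁ + T), toFraction P p ∈
        algClosureIn F (W : Set (FractionRing (LaurentRing F n ⧸ P))) := by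
      intro p hp
      induction hp using AddSubmonoid.closure_induction with
      | mem p hp =>
        obtain ⟨f, c, hf, rfl⟩ := hp
        rw [single_eq_mul_mono, map_mul, AlgHom.commutes]
        exact mul_mem_algClosureIn (algebraMap_mem_algClosureIn c)
          (mem_of_natDegree_lt hG hf)
      | zero =>
        rw [map_zero, ← map_zero (algebraMap F _)]
        exact algebraMap_mem_algClosureIn 0
      | add p q _ _ hp hq => rw [map_add]; exact add_mem_algClosureIn hp hq
    refine (hS.card_mul_le ht T fun a ha k hk => ?_).trans hWcard
    rw [hnd a, ← RingHom.coe_pow, map_div₀, RingHom.coe_pow, iterate_fractionShift_toFraction,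
      iterate_fractionShift_toFraction, div_eq_mul_inv]
    have hmem : ∀ p ∈ t.image num ∪ t.image den,
        (shift σ n)^[k] p ∈ degreeBounded F n (N₁ + T) := fun p hp =>
      degreeBounded_mono (by omega) (iterate_shift_mem_degreeBounded (hN₁ p hp) k)
    exact mul_mem_algClosureIn
      (hbdd _ (hmem _ (Finset.mem_union_left _ (Finset.mem_image_of_mem _ ha))))
      (inv_mem_algClosureIn
        (hbdd _ (hmem _ (Finset.mem_union_right _ (Finset.mem_image_of_mem _ ha)))))
  by_contra! hlt
  -- If |t| ≥ |s| + 1, then `key` leaves T ≤ nd + |s|(N₁ + D); this T is one too large.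
  have h1 := key (n * d + s.card * (N₁ + D) + 1)
  have h2 := Nat.mul_le_mul_right (n * d + s.card * (N₁ + D) + 1) (Nat.succ_le_of_lt hlt)
  rw [Nat.succ_mul] at h2
  have h3 : s.card * (N₁ + (n * d + s.card * (N₁ + D) + 1) + D) =
      s.card * (N₁ + D) + s.card * (n * d + s.card * (N₁ + D) + 1) := by ring
  omega

theorem sigmaIndependent_range {N : Submodule ℤ[X] (Fin n → ℤ[X])}
    (hP : IsReflexivePrime (shift σ n) P) (hker : RingHom.ker (gradedClass P N) = P) {ι : Type*}
    {e : ι → Fin n → ℤ[X]} (he : LinearIndependent ℤ[X] (fun i => N.mkQ (e i))) :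
    Function.Injective (fun i => toFraction P (mono F (e i))) ∧
      SigmaIndependent F hP.fractionShift (Set.range fun i => toFraction P (mono F (e i))) := by
  have h0 := linearIndependent_X_pow_smul he
  simp only [← map_smul] at h0
  have h1 : AlgebraicIndependent F
      (fun q : ι × ℕ => toFraction P (mono F ((X ^ q.2 : ℤ[X]) • e q.1))) :=
    algebraicIndependent_toFraction_mono hP.prime hker h0
  have := hP.prime
  refine sigmaIndependent_range_of_algebraicIndependent ?_
  simpa only [iterate_fractionShift_toFraction, iterate_shift_mono] using h1

theorem exists_dimension_eq (F : Type*) [Field F] (σ : F →+* F)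
    (N : Submodule ℤ[X] (Fin n → ℤ[X])) :
    ∃ r : ℕ, ∀ (P : Ideal (LaurentRing F n)) (hP : IsReflexivePrime (shift σ n) P),
      (∀ f ∈ N, f ∈ supportLattice P) → constPart P N = P → hP.dimension F = r := by
  obtain ⟨s, hs, d, D, hgrowth⟩ := exists_linearIndependent_growth N (stdVec n)
  refine ⟨s.card, fun P hP hN hPN => le_antisymm (iSup_le fun S => ?_) ?_⟩
  · by_contra! hlt
    obtain ⟨t, htS, ht⟩ := Set.exists_subset_encard_eq (Order.add_one_le_of_lt hlt)
    have hfin : t.Finite := Set.finite_of_encard_eq_coe (k := s.card + 1) (by simpa using ht)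
    lift t to Finset (FractionRing (LaurentRing F n ⧸ P)) using hfin
    have h := card_le_of_sigmaIndependent hP hN hgrowth S.2 htS
    rw [Set.encard_coe_eq_coe_finsetCard] at ht
    have ht' : t.card = s.card + 1 := by exact_mod_cast ht
    omega
  -- The variables y_j with j in s attain the bound.
  · obtain ⟨hinj, hind⟩ := sigmaIndependent_range hP
      ((ker_gradedClass hP.prime.ne_top hN).trans hPN) hs
    refine le_trans (le_of_eq ?_) (le_iSup (fun S : {S : Set (FractionRing (LaurentRing F n ⧸ P)) //
      SigmaIndependent F hP.fractionShift S} => S.1.encard) ⟨_, hind⟩)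
    have h := hinj.encard_image Set.univ
    rw [Set.image_univ, Set.encard_univ] at h
    rw [h]
    simp

end Dimension
end LaurentDiff

theorem mainTheorem7 {F : Type*} [Field F] [CharZero F] [IsAlgClosed F]
    (σ : F →+* F) (hσ : Function.Bijective σ) (n : ℕ)
    (I : Ideal (LaurentDiff.LaurentRing F n)) (hI : LaurentDiff.IsLaurentBinomial σ I) :
    (LaurentDiff.perfectClosure (LaurentDiff.shift σ n) I = ⊤ ∨
      ∃ S : Set (Ideal (LaurentDiff.LaurentRing F n)), S.Finite ∧ S.Nonempty ∧
        (∀ P ∈ S, LaurentDiff.IsReflexivePrime (LaurentDiff.shift σ n) P ∧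
          LaurentDiff.IsLaurentBinomial σ P ∧
          LaurentDiff.supportLattice P =
            LaurentDiff.saturation (LaurentDiff.supportLattice I)) ∧
        LaurentDiff.perfectClosure (LaurentDiff.shift σ n) I = sInf S) ∧
    LaurentDiff.IsDimensionallyUnmixed F (LaurentDiff.shift σ n) I := by
  open LaurentDiff in
  have hdiff := hI.isDiffIdeal
  refine ⟨?_, fun P Q hP hQ => ?_⟩
  · rw [perfectClosure_eq_sInf_binomialPrimes hσ hI]
    rcases (binomialPrimes σ I hdiff).eq_empty_or_nonempty with h | h
    · left
      rw [h, sInf_empty]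
    · refine Or.inr ⟨_, finite_binomialPrimes hσ hdiff, h, fun P hP => ⟨hP.1, ?_,
        supportLattice_of_mem_binomialPrimes hσ hP⟩, rfl⟩
      have h1 := isLaurentBinomial_constPart (σ := σ) (hP.2.2.symm ▸ hP.1.diff)
      rwa [hP.2.2] at h1
  · obtain ⟨r, hr⟩ := exists_dimension_eq F σ (saturationSubmodule (supportSubmodule hdiff))
    have hPm := hP.mem_binomialPrimes hσ hI
    have hQm := hQ.mem_binomialPrimes hσ hI
    rw [hr P hP.prop.1 (fun f hf =>
        saturation_subset_supportLattice hσ hdiff hP.prop.1 hP.prop.2 hf) hPm.2.2,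
      hr Q hQ.prop.1 (fun f hf =>
        saturation_subset_supportLattice hσ hdiff hQ.prop.1 hQ.prop.2 hf) hQm.2.2]
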